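/- Let $L$ be a countable language (relation, function and constant symbols), and let $\mathcal M$ be a countable infinite $L$-structure. Let $S_L$ be the set of $L$-structures with underlying set $\mathbb N$, equipped with the $\sigma$-algebra generated by the sets $\{\mathcal N : R^{\mathcal N}(n_1,\dots,n_j)\}$, $\{\mathcal N : c^{\mathcal N}=\ell\}$ and $\{\mathcal N : f^{\mathcal N}(n_1,\dots,n_k)=\ell\}$ for symbols $R,c,f$ of $L$ and natural numbers $n_i,\ell$. The group $\mathrm{Sym}(\mathbb N)$ acts on $S_L$ by permuting the underlying set. A probability measure $\mu$ on $S_L$ is *invariant* if $\mu(g\cdot X)=\mu(X)$ for all $g\in \mathrm{Sym}(\mathbb N)$ and all measurable $X\subseteq S_L$, and it is *concentrated on* $\mathcal M$ if $\mu(\{\mathcal N\in S_L:\mathcal N\cong\mathcal M\})=1$. A *Scott sentence* of $\mathcal M$ is a sentence $\sigma_{\mathcal M}$ of the infinitary logic $\mathcal L_{\omega_1,\omega}(L)$ such that, for every countable $L$-structure $\mathcal N$, $\mathcal N\models\sigma_{\mathcal M}$ if and only if $\mathcal N\cong\mathcal M$ (such a sentence exists and is unique up to logical equivalence). $\mathcal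 M$ is *absolutely characterizable* if its Scott sentence has no uncountable models. $\mathcal M$ has *trivial definable closure* if for every finite tuple $\mathbf a$ of elements of $\mathcal M$, the only elements fixed by all automorphisms of $\mathcal M$ that fix $\mathbf a$ pointwise are the entries of $\mathbf a$; otherwise it has *nontrivial definable closure*. If the Scott sentence $\sigma_{\mathcal M}$ of $\mathcal M$ has no model of cardinality $2^{\aleph_0}$, then no invariant probability measure on $S_L$ is concentrated on $\mathcal M$, and $\mathcal M$ has nontrivial definable closure. In particular, if $\mathcal M$ is absolutely characterizable, then no invariant probability measure on $S_L$ is concentrated on $\mathcal M$, and $\mathcal M$ has nontrivial definable closure. -/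

import Mathlib

open FirstOrder

universe u v w

/-- Formulas of the infinitary logic `L_{ω₁,ω}(L)` whose free variables are among
`x₀, …, x_{n-1}`.  They are built from atomic formulas by negation, existential quantification
(`ex φ` binds the last variable of `φ`) and conjunctions over arbitrary countable index sets.
Since all conjuncts share the same finite list of free variables, every formula has only finitely
many free variables. -/
inductive InfFormula (L : FirstOrder.Language.{u, v}) : ℕ → Type (max u v 1)
  | equal {n : ℕ} (t₁ t₂ : L.Term (Fin n)) : InfFormula L n
  | rel {n l : ℕ} (R : L.Relations l) (ts : Fin l → L.Term (Fin n)) : InfFormula L n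
  | neg {n : ℕ} (φ : InfFormula L n) : InfFormula L n
  | ex {n : ℕ} (φ : InfFormula L (n + 1)) : InfFormula L n
  | conj {n : ℕ} (I : Type) [Countable I] (φ : I → InfFormula L n) : InfFormula L n

/-- A sentence of `L_{ω₁,ω}(L)`: a formula without free variables. -/
abbrev InfSentence (L : FirstOrder.Language.{u, v}) : Type (max u v 1) := InfFormula L 0

/-- Satisfaction `N ⊨ φ(x₀, …, x_{n-1})`. -/
def InfFormula.Realize {L : FirstOrder.Language.{u, v}} (N : Type w) [L.Structure N] :
    {n : ℕ} → InfFormula L n → (Fin n → N) → Prop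
  | _, .equal t₁ t₂, x => t₁.realize x = t₂.realize x
  | _, .rel R ts, x => FirstOrder.Language.Structure.RelMap R (fun i => (ts i).realize x)
  | _, .neg φ, x => ¬ φ.Realize N x
  | _, .ex φ, x => ∃ a : N, φ.Realize N (Fin.snoc x a)
  | _, @InfFormula.conj _ _ I _ φ, x => ∀ i : I, (φ i).Realize N x

/-- `N ⊨ σ` for a sentence `σ`. -/
def InfSentence.Holds {L : FirstOrder.Language.{u, v}} (σ : InfSentence L) (N : Type w) [L.Structure N] :
    Prop :=
  InfFormula.Realize N σ Fin.elim0

/-- `σ` is a Scott sentence of `M`: a countable (nonempty) structure satisfies `σ` if and only if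
it is isomorphic to `M`.  Every countable structure has an isomorphic copy in `Type`, so nothing is
lost by letting `N` range over `Type`. -/
def IsScottSentence {L : FirstOrder.Language.{u, v}} (M : Type w) [L.Structure M] (σ : InfSentence L) : Prop :=
  ∀ (N : Type) [L.Structure N] [Nonempty N] [Countable N], σ.Holds N ↔ Nonempty (N ≃[L] M)

/-- `σ` has a model whose underlying set has the cardinality of the continuum. -/
def HasContinuumSizedModel {L : FirstOrder.Language.{u, v}} (σ : InfSentence L) : Prop :=
  ∃ (N : Type) (_ : L.Structure N), Cardinal.mk N = Cardinal.continuum ∧ σ.Holds N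

/-- `M` is absolutely characterizable: its Scott sentence (which is unique up to logical
equivalence) has no uncountable models. -/
def AbsolutelyCharacterizable (L : FirstOrder.Language.{u, v}) (M : Type w) [L.Structure M] : Prop :=
  ∃ σ : InfSentence L, IsScottSentence M σ ∧
    ∀ (N : Type) [L.Structure N] [Uncountable N], ¬ σ.Holds N

/-- The space `S_L` of `L`-structures with underlying set `ℕ`. -/
abbrev StructureSpace (L : FirstOrder.Language.{u, v}) : Type (max u v) := L.Structure ℕ

/-- The `σ`-algebra on `S_L` generated by the sets `{𝒩 | R^𝒩(n₁, …, n_j)}` and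
`{𝒩 | f^𝒩(n₁, …, n_k) = ℓ}`.  Constant symbols are the `0`-ary function symbols. -/
instance StructureSpace.measurableSpace (L : FirstOrder.Language.{u, v}) :
    MeasurableSpace (StructureSpace L) :=
  MeasurableSpace.generateFrom
    ({X | ∃ (j : ℕ) (R : L.Relations j) (x : Fin j → ℕ),
        X = {𝒩 : StructureSpace L | 𝒩.RelMap R x}} ∪
     {X | ∃ (k : ℕ) (f : L.Functions k) (x : Fin k → ℕ) (l : ℕ),
        X = {𝒩 : StructureSpace L | 𝒩.funMap f x = l}})

/-- The logic action of the permutations of `ℕ` on `S_L`: the structure `g · 𝒩` is the one for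
which `g : 𝒩 → g · 𝒩` is an isomorphism. -/
@[reducible] def logicAction {L : FirstOrder.Language.{u, v}} (g : Equiv.Perm ℕ) (𝒩 : StructureSpace L) :
    StructureSpace L where
  funMap f x := g (𝒩.funMap f (fun i => g.symm (x i)))
  RelMap R x := 𝒩.RelMap R (fun i => g.symm (x i))

/-- A measure on `S_L` is invariant if `μ (g · X) = μ X` for all permutations `g` of `ℕ` and all
Borel sets `X`. -/
def IsLogicInvariant {L : FirstOrder.Language.{u, v}} (μ : MeasureTheory.Measure (StructureSpace L)) : Prop :=
  ∀ (g : Equiv.Perm ℕ) (X : Set (StructureSpace L)), MeasurableSet X →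
    μ (logicAction g '' X) = μ X

/-- The isomorphism class `{𝒩 ∈ S_L | 𝒩 ≅ M}` of `M` in `S_L`. -/
def isoClass (L : FirstOrder.Language.{u, v}) (M : Type w) [L.Structure M] : Set (StructureSpace L) :=
  {𝒩 | letI : L.Structure ℕ := 𝒩; Nonempty (ℕ ≃[L] M)}

/-- `M` admits an invariant measure: there is an invariant probability measure on `S_L` that is
concentrated on the isomorphism class of `M`. -/
def AdmitsInvariantMeasure (L : FirstOrder.Language.{u, v}) (M : Type w) [L.Structure M] : Prop :=
  ∃ μ : MeasureTheory.Measure (StructureSpace L),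
    MeasureTheory.IsProbabilityMeasure μ ∧ IsLogicInvariant μ ∧ μ (isoClass L M) = 1

/-- The group-theoretic definable closure of a finite tuple `a` in `M`: the elements fixed by all
automorphisms of `M` that fix `a` pointwise. -/
def groupDcl (L : FirstOrder.Language.{u, v}) {M : Type w} [L.Structure M] {n : ℕ} (a : Fin n → M) : Set M :=
  {b | ∀ g : M ≃[L] M, (∀ i, g (a i) = a i) → g b = b}

/-- `M` has trivial definable closure: `dcl(a) = a` for every finite (possibly empty) tuple. -/
def HasTrivialDcl (L : FirstOrder.Language.{u, v}) (M : Type w) [L.Structure M] : Prop :=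
  ∀ (n : ℕ) (a : Fin n → M), groupDcl L a = Set.range a

/-! Both conclusions come by contraposition: an invariant measure forces trivial definable closure,
and trivial definable closure gives every sentence true in M a model of size continuum.

For the first (`AdmitsInvariantMeasure.hasTrivialDcl`), let b lie in dcl(a) without being an entry
of a. Back-and-forth provides a formula θ of L_{ω₁,ω} defining the orbit of (a, b)
(`exists_formula_orbit`), so the events θ(x, y) are measurable. For fixed x and y outside x they
have equal probability by invariance, and they are disjoint up to null sets because a determines b.
Being infinitely many, they are null, yet countably many such events cover the isomorphism class.

For the second (`HasTrivialDcl.hasContinuumSizedModel`), a model is built on ℕ × 2^ℕ. A finite stage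
labels finitely many cones by distinct elements of M. Trivial definable closure lets every label
split in two so that each selection of halves is conjugate to the old tuple
(`HasTrivialDcl.exists_duplicate`). A sequence of stages that separates all points and realizes all
one-point extensions has a limit that is back-and-forth equivalent to M
(`Approx.IsGeneric.holds_iff`). -/

/-! ### Back-and-forth systems and infinitary formulas -/

/-- A system of partial correspondences between `N` and `M` that respects atomic formulas and has
the back-and-forth property respects all formulas of `L_{ω₁,ω}`. -/
theorem InfFormula.realize_iff_of_backForth {L : FirstOrder.Language.{u, v}} {N : Type*}
    {M : Type*} [L.Structure N] [L.Structure M]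
    (I : ∀ n : ℕ, (Fin n → N) → (Fin n → M) → Prop)
    (hequal : ∀ n x a, I n x a → ∀ t₁ t₂ : L.Term (Fin n),
      t₁.realize x = t₂.realize x ↔ t₁.realize a = t₂.realize a)
    (hrel : ∀ n x a, I n x a → ∀ (l : ℕ) (R : L.Relations l) (ts : Fin l → L.Term (Fin n)),
      FirstOrder.Language.Structure.RelMap R (fun i => (ts i).realize x) ↔
        FirstOrder.Language.Structure.RelMap R (fun i => (ts i).realize a))
    (forth : ∀ n x a, I n x a → ∀ y, ∃ b, I (n + 1) (Fin.snoc x y) (Fin.snoc a b))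
    (back : ∀ n x a, I n x a → ∀ b, ∃ y, I (n + 1) (Fin.snoc x y) (Fin.snoc a b))
    {n : ℕ} (φ : InfFormula L n) {x : Fin n → N} {a : Fin n → M} (h : I n x a) :
    φ.Realize N x ↔ φ.Realize M a := by
  induction φ with
  | equal t₁ t₂ => exact hequal _ x a h t₁ t₂
  | rel R ts => exact hrel _ x a h _ R ts
  | neg φ ih => exact not_congr (ih h)
  | ex φ ih =>
    constructor
    · rintro ⟨y, hy⟩
      obtain ⟨b, hb⟩ := forth _ x a h y
      exact ⟨b, (ih hb).1 hy⟩
    · rintro ⟨b, hb⟩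
      obtain ⟨y, hy⟩ := back _ x a h b
      exact ⟨y, (ih hy).2 hb⟩
  | conj I φ ih => exact forall_congr' fun i => ih i h

theorem InfFormula.realize_equiv {L : FirstOrder.Language.{u, v}} {N : Type*}
    {M : Type*} [L.Structure N] [L.Structure M] (e : N ≃[L] M) {n : ℕ} (φ : InfFormula L n)
    (x : Fin n → N) : φ.Realize M (e ∘ x) ↔ φ.Realize N x := by
  refine (InfFormula.realize_iff_of_backForth (fun n x a => a = e ∘ x) ?_ ?_ ?_ ?_ φ rfl).symm
  · rintro n x a rfl t₁ t₂
    simp [FirstOrder.Language.HomClass.realize_term]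
  · rintro n x a rfl l R ts
    simp only [FirstOrder.Language.HomClass.realize_term]
    exact (e.map_rel R _).symm
  · rintro n x a rfl y
    exact ⟨e y, by rw [Fin.comp_snoc]⟩
  · rintro n x a rfl b
    exact ⟨e.symm b, by rw [Fin.comp_snoc]; simp⟩

theorem InfSentence.holds_equiv {L : FirstOrder.Language.{u, v}} {N : Type*}
    {M : Type*} [L.Structure N] [L.Structure M] (e : N ≃[L] M) (σ : InfSentence L) :
    σ.Holds M ↔ σ.Holds N := by
  rw [InfSentence.Holds, InfSentence.Holds, ← InfFormula.realize_equiv e σ]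
  exact iff_of_eq (congrArg _ (Subsingleton.elim _ _))

/-- Scott sentences are tested only on structures in `Type`, so M is first replaced by a copy on ℕ.
-/
theorem IsScottSentence.holds {L : FirstOrder.Language.{u, v}} {M : Type w} [L.Structure M]
    [Countable M] [Infinite M] {σ : InfSentence L} (h : IsScottSentence M σ) : σ.Holds M := by
  obtain ⟨e⟩ := nonempty_equiv_of_countable (α := M) (β := ℕ)
  let _ : L.Structure ℕ := e.inducedStructure
  have e' : M ≃[L] ℕ := e.inducedStructureEquiv
  exact (InfSentence.holds_equiv e' σ).1 ((h ℕ).2 ⟨e'.symm⟩)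

/-! ### Infinitary types and automorphism orbits -/

/-- Two tuples of `M` satisfying the same formulas of `L_{ω₁,ω}`. -/
def SameInfType (L : FirstOrder.Language.{u, v}) {M : Type w} [L.Structure M] {n : ℕ}
    (a b : Fin n → M) : Prop :=
  ∀ φ : InfFormula L n, φ.Realize M a ↔ φ.Realize M b

theorem SameInfType.symm {L : FirstOrder.Language.{u, v}} {M : Type w} [L.Structure M] {n : ℕ}
    {a b : Fin n → M} (h : SameInfType L a b) : SameInfType L b a := fun φ => (h φ).symm

theorem exists_realize_of_not_sameInfType {L : FirstOrder.Language.{u, v}} {M : Type w}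
    [L.Structure M] {n : ℕ} {a b : Fin n → M} (h : ¬ SameInfType L a b) :
    ∃ φ : InfFormula L n, φ.Realize M a ∧ ¬ φ.Realize M b := by
  simp only [SameInfType, not_forall] at h
  obtain ⟨φ, hφ⟩ := h
  by_cases ha : φ.Realize M a
  · exact ⟨φ, ha, fun hb => hφ (iff_of_true ha hb)⟩
  · exact ⟨φ.neg, ha, fun hb => hφ (iff_of_false ha hb)⟩

/-- If every d failed, the countably many formulas separating c from the d's could be conjoined; the
existential closure of the conjunction holds at a but not at b. -/
theorem SameInfType.forth {L : FirstOrder.Language.{u, v}} {M : Type w} [L.Structure M]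
    [Countable M] {n : ℕ} {a b : Fin n → M} (h : SameInfType L a b) (c : M) :
    ∃ d, SameInfType L (Fin.snoc a c : Fin (n + 1) → M) (Fin.snoc b d) := by
  by_contra! hd
  choose φ hφa hφb using fun d => exists_realize_of_not_sameInfType (hd d)
  have : Nonempty M := ⟨c⟩
  obtain ⟨e, he⟩ := exists_surjective_nat M
  obtain ⟨d, hd⟩ := (h (.ex (.conj ℕ fun i => φ (e i)))).1 ⟨c, fun i => hφa (e i)⟩
  obtain ⟨i, rfl⟩ := he d
  exact hφb (e i) (hd i)

/-- A finite partial map of `M` preserving all formulas of `L_{ω₁,ω}`. -/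
structure PartialMatch (L : FirstOrder.Language.{u, v}) (M : Type w) [L.Structure M] where
  card : ℕ
  src : Fin card → M
  tgt : Fin card → M
  same : SameInfType L src tgt

/-- The pair `(c, d)` belongs to the graph of `p`. -/
def PartialMatch.Rel {L : FirstOrder.Language.{u, v}} {M : Type w} [L.Structure M]
    (p : PartialMatch L M) (c d : M) : Prop :=
  ∃ i, p.src i = c ∧ p.tgt i = d

instance PartialMatch.preorder {L : FirstOrder.Language.{u, v}} {M : Type w} [L.Structure M] :
    Preorder (PartialMatch L M) where
  le p q := ∀ c d, p.Rel c d → q.Rel c d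
  le_refl _ _ _ h := h
  le_trans _ _ _ h₁ h₂ c d h := h₂ c d (h₁ c d h)

theorem PartialMatch.exists_src {L : FirstOrder.Language.{u, v}} {M : Type w} [L.Structure M]
    [Countable M] (p : PartialMatch L M) (c : M) : ∃ q ≥ p, ∃ d, q.Rel c d := by
  obtain ⟨d, hd⟩ := p.same.forth c
  refine ⟨⟨_, _, _, hd⟩, ?_, d, Fin.last _, by simp, by simp⟩
  rintro _ _ ⟨i, rfl, rfl⟩
  exact ⟨i.castSucc, by simp, by simp⟩

theorem PartialMatch.exists_tgt {L : FirstOrder.Language.{u, v}} {M : Type w} [L.Structure M]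
    [Countable M] (p : PartialMatch L M) (d : M) : ∃ q ≥ p, ∃ c, q.Rel c d := by
  obtain ⟨c, hc⟩ := p.same.symm.forth d
  refine ⟨⟨_, _, _, hc.symm⟩, ?_, c, Fin.last _, by simp, by simp⟩
  rintro _ _ ⟨i, rfl, rfl⟩
  exact ⟨i.castSucc, by simp, by simp⟩

/-- In a countable structure, tuples with the same `L_{ω₁,ω}`-type are in the same orbit. -/
theorem SameInfType.exists_equiv {L : FirstOrder.Language.{u, v}} {M : Type w} [L.Structure M]
    [Countable M] {n : ℕ} {a b : Fin n → M} (h : SameInfType L a b) :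
    ∃ g : M ≃[L] M, ∀ i, g (a i) = b i := by
  classical
  have := Encodable.ofCountable M
  let D : M ⊕ M → Order.Cofinal (PartialMatch L M)
    | .inl c => ⟨{q | ∃ d, q.Rel c d}, fun p => let ⟨q, hq, hd⟩ := p.exists_src c; ⟨q, hd, hq⟩⟩
    | .inr d => ⟨{q | ∃ c, q.Rel c d}, fun p => let ⟨q, hq, hc⟩ := p.exists_tgt d; ⟨q, hc, hq⟩⟩
  let s := Order.sequenceOfCofinals (⟨n, a, b, h⟩ : PartialMatch L M) D
  have mono : Monotone s := Order.sequenceOfCofinals.monotone _ _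
  have total (c : M) : ∃ d k, (s k).Rel c d := by
    obtain ⟨d, hd⟩ := Order.sequenceOfCofinals.encode_mem (⟨n, a, b, h⟩ : PartialMatch L M) D (.inl c)
    exact ⟨d, _, hd⟩
  have onto (d : M) : ∃ c k, (s k).Rel c d := by
    obtain ⟨c, hc⟩ := Order.sequenceOfCofinals.encode_mem (⟨n, a, b, h⟩ : PartialMatch L M) D (.inr d)
    exact ⟨c, _, hc⟩
  have eventually {c d : M} {k : ℕ} (hk : (s k).Rel c d) :
      ∀ᶠ j in Filter.atTop, (s j).Rel c d := by
    filter_upwards [Filter.eventually_ge_atTop k] with j hj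
    exact mono hj c d hk
  -- Both pairs lie in one stage, which preserves equality; this gives single-valuedness and
  -- injectivity at once.
  have eq_iff {c d c' d' : M} {k k' : ℕ} (hk : (s k).Rel c d) (hk' : (s k').Rel c' d') :
      c = c' ↔ d = d' := by
    obtain ⟨j, ⟨i, rfl, rfl⟩, ⟨i', rfl, rfl⟩⟩ := ((eventually hk).and (eventually hk')).exists
    exact (s j).same (.equal (.var i) (.var i'))
  choose f kf hf using total
  choose g kg hg using onto
  refine ⟨⟨⟨f, g, fun c => ?_, fun d => ?_⟩, fun {l} F x => ?_, fun {l} R x => ?_⟩, fun i => ?_⟩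
  · exact (eq_iff (hg _) (hf c)).2 rfl
  · exact (eq_iff (hf _) (hg d)).1 rfl
  · obtain ⟨j, ⟨i₀, h₀, h₀'⟩, hj⟩ := ((eventually (hf (FirstOrder.Language.Structure.funMap F x))).and
      (Filter.eventually_all.2 fun i : Fin l => eventually (hf (x i)))).exists
    choose r hr hr' using hj
    have := ((s j).same (.equal (.var i₀) (.func F fun i => .var (r i)))).1
    simp only [InfFormula.Realize, FirstOrder.Language.Term.realize, h₀, h₀', hr, hr'] at this
    exact this trivial
  · obtain ⟨j, hj⟩ := (Filter.eventually_all.2 fun i : Fin l => eventually (hf (x i))).exists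
    choose r hr hr' using hj
    have := (s j).same (.rel R fun i => .var (r i))
    simp only [InfFormula.Realize, FirstOrder.Language.Term.realize, hr, hr'] at this
    exact this.symm
  · exact (eq_iff (hf (a i)) (show (s 0).Rel (a i) (b i) from ⟨i, rfl, rfl⟩)).1 rfl

/-- Orbits of tuples of a countable structure are definable in `L_{ω₁,ω}`. -/
theorem exists_formula_orbit {L : FirstOrder.Language.{u, v}} {M : Type w} [L.Structure M]
    [Countable M] {n : ℕ} (a : Fin n → M) :
    ∃ θ : InfFormula L n, ∀ b, θ.Realize M b ↔ ∃ g : M ≃[L] M, ∀ i, g (a i) = b i := by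
  have key (b : Fin n → M) :
      ∃ φ : InfFormula L n, φ.Realize M a ∧ (φ.Realize M b → SameInfType L a b) := by
    by_cases h : SameInfType L a b
    -- The empty conjunction serves as the true formula.
    · exact ⟨.conj Empty fun i => i.elim, fun i => i.elim, fun _ => h⟩
    · obtain ⟨φ, ha, hb⟩ := exists_realize_of_not_sameInfType h
      exact ⟨φ, ha, fun hb' => absurd hb' hb⟩
  choose φ hφa hφb using key
  have : Nonempty (Fin n → M) := ⟨a⟩
  obtain ⟨e, he⟩ := exists_surjective_nat (Fin n → M)
  have ha : (InfFormula.conj ℕ fun i => φ (e i)).Realize M a := fun i => hφa (e i)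
  refine ⟨.conj ℕ fun i => φ (e i), fun b => ⟨fun hb => ?_, ?_⟩⟩
  · obtain ⟨i, rfl⟩ := he b
    exact (hφb _ (hb i)).exists_equiv
  · rintro ⟨g, hg⟩
    obtain rfl : g ∘ a = b := funext hg
    exact (InfFormula.realize_equiv g _ a).2 ha

/-! ### Measurability and equivariance of satisfaction -/

theorem measurableSet_term_realize_eq {L : FirstOrder.Language.{u, v}} {n : ℕ} (x : Fin n → ℕ)
    (t : L.Term (Fin n)) (l : ℕ) :
    MeasurableSet {𝒩 : StructureSpace L |
      @FirstOrder.Language.Term.realize L ℕ 𝒩 (Fin n) x t = l} := by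
  induction t generalizing l with
  | var i => exact MeasurableSet.const (x i = l)
  | @func k f ts ih =>
    have : {𝒩 : StructureSpace L |
        @FirstOrder.Language.Term.realize L ℕ 𝒩 (Fin n) x (.func f ts) = l} =
        ⋃ y : Fin k → ℕ, (⋂ i, {𝒩 : StructureSpace L |
          @FirstOrder.Language.Term.realize L ℕ 𝒩 (Fin n) x (ts i) = y i}) ∩
          {𝒩 : StructureSpace L | 𝒩.funMap f y = l} := by
      ext 𝒩
      simp only [Set.mem_iUnion, Set.mem_inter_iff, Set.mem_iInter, Set.mem_ofPred_eq]
      constructor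
      · exact fun h => ⟨_, fun i => rfl, h⟩
      · rintro ⟨y, hy, rfl⟩
        obtain rfl := funext hy
        rfl
    rw [this]
    exact MeasurableSet.iUnion fun y => (MeasurableSet.iInter fun i => ih i _).inter
      (MeasurableSpace.measurableSet_generateFrom (.inr ⟨k, f, y, l, rfl⟩))

theorem measurable_term_realize {L : FirstOrder.Language.{u, v}} {n : ℕ} (x : Fin n → ℕ)
    (t : L.Term (Fin n)) : Measurable fun 𝒩 : StructureSpace L =>
      @FirstOrder.Language.Term.realize L ℕ 𝒩 (Fin n) x t :=
  measurable_to_countable' fun l => measurableSet_term_realize_eq x t l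

/-- The set of structures on `ℕ` in which a tuple satisfies a formula of `L_{ω₁,ω}`. -/
def realizeSet {L : FirstOrder.Language.{u, v}} {n : ℕ} (φ : InfFormula L n) (x : Fin n → ℕ) :
    Set (StructureSpace L) :=
  {𝒩 | @InfFormula.Realize L ℕ 𝒩 n φ x}

theorem measurableSet_realizeSet {L : FirstOrder.Language.{u, v}} {n : ℕ} (φ : InfFormula L n)
    (x : Fin n → ℕ) : MeasurableSet (realizeSet φ x) := by
  induction φ with
  | equal t₁ t₂ =>
    exact measurableSet_eq_fun (measurable_term_realize x t₁) (measurable_term_realize x t₂)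
  | @rel n k R ts =>
    have : realizeSet (.rel R ts) x = ⋃ y : Fin k → ℕ, (⋂ i, {𝒩 : StructureSpace L |
          @FirstOrder.Language.Term.realize L ℕ 𝒩 (Fin n) x (ts i) = y i}) ∩
          {𝒩 : StructureSpace L | 𝒩.RelMap R y} := by
      ext 𝒩
      simp only [Set.mem_iUnion, Set.mem_inter_iff, Set.mem_iInter, Set.mem_ofPred_eq]
      constructor
      · exact fun h => ⟨_, fun i => rfl, h⟩
      · rintro ⟨y, hy, h⟩
        obtain rfl := funext hy
        exact h
    rw [this]
    exact MeasurableSet.iUnion fun y => (MeasurableSet.iInter fun i =>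
      measurableSet_term_realize_eq x (ts i) _).inter
      (MeasurableSpace.measurableSet_generateFrom (.inl ⟨k, R, y, rfl⟩))
  | neg φ ih => exact (ih x).compl
  | ex φ ih =>
    convert MeasurableSet.iUnion fun a : ℕ => ih (Fin.snoc x a) using 1
    ext 𝒩
    simp [realizeSet, InfFormula.Realize]
  | conj I φ ih =>
    convert MeasurableSet.iInter fun i => ih i x using 1
    ext 𝒩
    simp [realizeSet, InfFormula.Realize]

theorem logicAction_mem_realizeSet_iff {L : FirstOrder.Language.{u, v}} {n : ℕ}
    (φ : InfFormula L n) (x : Fin n → ℕ) (g : Equiv.Perm ℕ) (𝒩 : StructureSpace L) :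
    logicAction g 𝒩 ∈ realizeSet φ (g ∘ x) ↔ 𝒩 ∈ realizeSet φ x := by
  let e : @FirstOrder.Language.Equiv L ℕ ℕ 𝒩 (logicAction g 𝒩) :=
    @FirstOrder.Language.Equiv.mk L ℕ ℕ 𝒩 (logicAction g 𝒩) g
      (fun {k} f y => by simp [FirstOrder.Language.Structure.funMap])
      (fun {k} R y => by simp [FirstOrder.Language.Structure.RelMap])
  exact @InfFormula.realize_equiv L ℕ ℕ 𝒩 (logicAction g 𝒩) e n φ x

theorem logicAction_image_realizeSet {L : FirstOrder.Language.{u, v}} {n : ℕ}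
    (φ : InfFormula L n) (x : Fin n → ℕ) (g : Equiv.Perm ℕ) :
    logicAction g '' realizeSet φ x = realizeSet φ (g ∘ x) := by
  ext 𝒩
  constructor
  · rintro ⟨𝒩, h, rfl⟩
    exact (logicAction_mem_realizeSet_iff φ x g 𝒩).2 h
  · intro h
    have h𝒩 : logicAction g (logicAction g.symm 𝒩) = 𝒩 := by
      cases 𝒩
      simp [logicAction, Function.comp_def]
    refine ⟨logicAction g.symm 𝒩, ?_, h𝒩⟩
    rwa [← logicAction_mem_realizeSet_iff φ x g, h𝒩]

/-! ### Invariant measures force trivial definable closure -/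

theorem exists_not_mem_range_of_not_hasTrivialDcl {L : FirstOrder.Language.{u, v}} {M : Type w}
    [L.Structure M] (h : ¬ HasTrivialDcl L M) :
    ∃ (n : ℕ) (a : Fin n → M) (b : M), b ∈ groupDcl L a ∧ b ∉ Set.range a := by
  simp only [HasTrivialDcl, not_forall] at h
  obtain ⟨n, a, h⟩ := h
  by_contra! H
  refine h (Set.Subset.antisymm (H n a) ?_)
  rintro _ ⟨i, rfl⟩ g hg
  exact hg i

/-- A structure carrying an invariant measure has trivial definable closure. -/
theorem AdmitsInvariantMeasure.hasTrivialDcl {L : FirstOrder.Language.{u, v}} {M : Type w}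
    [L.Structure M] [Countable M] (h : AdmitsInvariantMeasure L M) : HasTrivialDcl L M := by
  by_contra hdcl
  obtain ⟨n, a, b, hb, hba⟩ := exists_not_mem_range_of_not_hasTrivialDcl hdcl
  obtain ⟨μ, hμ, hinv, hiso⟩ := h
  obtain ⟨θ, hθ⟩ := exists_formula_orbit (L := L) (Fin.snoc a b : Fin (n + 1) → M)
  let A : (Fin n → ℕ) → ℕ → Set (StructureSpace L) := fun x y => realizeSet θ (Fin.snoc x y)
  have hA (x y) : MeasurableSet (A x y) := measurableSet_realizeSet _ _
  -- Only S need be measurable: its complement contains the isomorphism class, whose own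
  -- measurability is not needed.
  have null {S : Set (StructureSpace L)} (hS : MeasurableSet S) (hd : Disjoint S (isoClass L M)) :
      μ S = 0 := by
    rw [← MeasureTheory.prob_compl_eq_one_iff hS]
    exact le_antisymm MeasureTheory.prob_le_one (hiso ▸ MeasureTheory.measure_mono
      hd.subset_compl_left)
  have mem_A {𝒩 : StructureSpace L} (e : @FirstOrder.Language.Equiv L ℕ M 𝒩 _) (x y) :
      𝒩 ∈ A x y ↔ ∃ g : M ≃[L] M, (∀ i, g (a i) = e (x i)) ∧ g b = e y := by
    have := (@InfFormula.realize_equiv L ℕ M 𝒩 _ e _ θ (Fin.snoc x y)).symm.trans (hθ _)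
    refine Iff.trans this (exists_congr fun g => ?_)
    rw [Fin.forall_fin_succ']
    simp
  have zero (x y) : μ (A x y) = 0 := by
    by_cases hy : y ∈ Set.range x
    · refine null (hA x y) (Set.disjoint_left.2 ?_)
      rintro 𝒩 h𝒩 ⟨e⟩
      obtain ⟨i, rfl⟩ := hy
      obtain ⟨g, hg, hgb⟩ := (mem_A e _ _).1 h𝒩
      exact hba ⟨i, g.injective ((hg i).trans hgb.symm)⟩
    · have hinf : Infinite ↥(Set.range x)ᶜ := (Set.finite_range x).infinite_compl.to_subtype
      -- The transposition of y and z fixes x pointwise.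
      have const (z : ↥(Set.range x)ᶜ) : μ (A x z) = μ (A x y) := by
        have hx : Equiv.swap y z ∘ x = x := funext fun j =>
          Equiv.swap_apply_of_ne_of_ne (fun h => hy ⟨j, h⟩) (fun h => z.2 ⟨j, h⟩)
        rw [← hinv (Equiv.swap y z) _ (hA x y), logicAction_image_realizeSet, Fin.comp_snoc,
          Equiv.swap_apply_left, hx]
      have disj : Pairwise (Function.onFun (MeasureTheory.AEDisjoint μ)
          fun z : ↥(Set.range x)ᶜ => A x z) := by
        intro z z' hz
        refine null ((hA x z).inter (hA x z')) (Set.disjoint_left.2 ?_)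
        rintro 𝒩 ⟨h₁, h₂⟩ ⟨e⟩
        obtain ⟨g, hg, hgb⟩ := (mem_A e _ _).1 h₁
        obtain ⟨g', hg', hgb'⟩ := (mem_A e _ _).1 h₂
        -- g and g' agree on a, so g'⁻¹g fixes a and hence b.
        have := hb (g'.symm.comp g) fun i => by
          rw [FirstOrder.Language.Equiv.comp_apply, hg, ← hg', g'.symm_apply_apply]
        rw [FirstOrder.Language.Equiv.comp_apply] at this
        have : g b = g' b := by rw [← this, g'.apply_symm_apply, this]
        rw [hgb, hgb'] at this
        exact hz (Subtype.ext (e.injective this))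
      have hsum := MeasureTheory.tsum_measure_le_measure_univ
        (fun z : ↥(Set.range x)ᶜ => (hA x z).nullMeasurableSet) disj
      by_contra h0
      simp only [const, ENNReal.tsum_const_eq_top_of_ne_zero h0, MeasureTheory.measure_univ] at hsum
      exact absurd hsum (by simp)
  have hcover : isoClass L M ⊆ ⋃ x, ⋃ y, A x y := by
    rintro 𝒩 ⟨e⟩
    rw [Set.mem_iUnion]
    refine ⟨fun i => (@FirstOrder.Language.Equiv.toEquiv L ℕ M 𝒩 _ e).symm (a i), ?_⟩
    rw [Set.mem_iUnion]
    refine ⟨(@FirstOrder.Language.Equiv.toEquiv L ℕ M 𝒩 _ e).symm b, ?_⟩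
    rw [mem_A e]
    exact ⟨.refl L M, fun i => ((@FirstOrder.Language.Equiv.toEquiv L ℕ M 𝒩 _ e).apply_symm_apply
      (a i)).symm, ((@FirstOrder.Language.Equiv.toEquiv L ℕ M 𝒩 _ e).apply_symm_apply b).symm⟩
  have : μ (isoClass L M) = 0 := MeasureTheory.measure_mono_null hcover
    (MeasureTheory.measure_iUnion_null fun x => MeasureTheory.measure_iUnion_null fun y =>
      zero x y)
  rw [hiso] at this
  exact one_ne_zero this

/-! ### Finite approximations on cones -/

/-- A finite approximation to a structure on `ℕ × (ℕ → Bool)`: the first `width` copies of the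
Cantor space are cut into cones of depth `depth`, and distinct cones carry distinct elements
of `M`. -/
structure Approx (L : FirstOrder.Language.{u, v}) (M : Type w) [L.Structure M] where
  width : ℕ
  depth : ℕ
  val : Fin width × (Fin depth → Bool) → M
  val_injective : Function.Injective val

namespace Approx

variable {L : FirstOrder.Language.{u, v}} {M : Type w} [L.Structure M]

instance [Countable M] : Countable (Approx L M) := by
  let f : Approx L M → Σ w d : ℕ, (Fin w × (Fin d → Bool) → M) :=
    fun p => ⟨p.width, p.depth, p.val⟩
  refine Function.Injective.countable (f := f) ?_
  rintro ⟨w, d, a, ha⟩ ⟨w', d', a', ha'⟩ h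
  simp only [f, Sigma.mk.injEq] at h
  obtain ⟨rfl, h⟩ := h
  simp only [heq_eq_eq, Sigma.mk.injEq] at h
  obtain ⟨rfl, h⟩ := h
  simp only [heq_eq_eq] at h
  subst h
  rfl

variable [Nonempty M]

open Classical in
/-- The element of `M` assigned to a point at the stage `p`. -/
noncomputable def eval (p : Approx L M) (x : ℕ × (ℕ → Bool)) : M :=
  if h : x.1 < p.width then p.val (⟨x.1, h⟩, fun i => x.2 i) else Classical.arbitrary M

theorem eval_of_lt (p : Approx L M) {x : ℕ × (ℕ → Bool)} (h : x.1 < p.width) :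
    p.eval x = p.val (⟨x.1, h⟩, fun i => x.2 i) := dif_pos h

/-- The points of `S` lie in pairwise distinct cones of `p`. -/
def Resolves (p : Approx L M) (S : Set (ℕ × (ℕ → Bool))) : Prop :=
  (∀ x ∈ S, x.1 < p.width) ∧ Set.InjOn p.eval S

/-- Labels may change along the order; what persists is the orbit of the labels of separated points,
and the automorphism may depend on S. This freedom is what allows cones to be split. -/
instance preorder : Preorder (Approx L M) where
  le p q := p.width ≤ q.width ∧
    ∀ S, p.Resolves S → ∃ h : M ≃[L] M, ∀ x ∈ S, h (p.eval x) = q.eval x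
  le_refl p := ⟨le_rfl, fun _ _ => ⟨.refl L M, fun _ _ => rfl⟩⟩
  le_trans p q r hpq hqr := by
    refine ⟨hpq.1.trans hqr.1, fun S hS => ?_⟩
    obtain ⟨g, hg⟩ := hpq.2 S hS
    obtain ⟨h, hh⟩ := hqr.2 S ⟨fun x hx => (hS.1 x hx).trans_le hpq.1, fun x hx y hy hxy =>
      hS.2 hx hy (g.injective (by rw [hg x hx, hg y hy, hxy]))⟩
    exact ⟨h.comp g, fun x hx => by rw [← hh x hx, ← hg x hx]; rfl⟩

theorem Resolves.mono {p q : Approx L M} {S : Set (ℕ × (ℕ → Bool))} (hS : p.Resolves S)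
    (h : p ≤ q) : q.Resolves S := by
  obtain ⟨g, hg⟩ := h.2 S hS
  exact ⟨fun x hx => (hS.1 x hx).trans_le h.1, fun x hx y hy hxy =>
    hS.2 hx hy (g.injective (by rw [hg x hx, hg y hy, hxy]))⟩

theorem exists_eval_of_mem_range {p : Approx L M} {m : M} (hm : m ∈ Set.range p.val) :
    ∃ x : ℕ × (ℕ → Bool), x.1 < p.width ∧ p.eval x = m := by
  obtain ⟨⟨j, s⟩, rfl⟩ := hm
  refine ⟨(j, fun i => if h : i < p.depth then s ⟨i, h⟩ else false), j.2, ?_⟩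
  rw [eval_of_lt _ j.2]
  simp

theorem eval_mem_range {p : Approx L M} {x : ℕ × (ℕ → Bool)} (h : x.1 < p.width) :
    p.eval x ∈ Set.range p.val := by
  rw [eval_of_lt _ h]
  exact ⟨_, rfl⟩

/-- Every element can be added to the range of an approximation in a new copy of the Cantor
space. -/
theorem exists_extend_mem [Infinite M] (p : Approx L M) (b : M) :
    ∃ q : Approx L M, q.width = p.width + 1 ∧ q.depth = p.depth ∧
      (∀ x : ℕ × (ℕ → Bool), x.1 < p.width → q.eval x = p.eval x) ∧ b ∈ Set.range q.val := by
  classical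
  have hinf : Infinite ↥(Set.range p.val)ᶜ :=
    (Set.finite_range p.val).infinite_compl.to_subtype
  obtain ⟨e, he⟩ : ∃ e : (Fin p.depth → Bool) ↪ ↥(Set.range p.val)ᶜ,
      b ∈ Set.range p.val ∨ b ∈ Set.range (fun s => (e s : M)) := by
    obtain ⟨e⟩ : Nonempty ((Fin p.depth → Bool) ↪ ↥(Set.range p.val)ᶜ) :=
      ⟨(Fintype.equivFin _).toEmbedding.trans
        (Fin.valEmbedding.trans (Infinite.natEmbedding ↥(Set.range p.val)ᶜ))⟩
    by_cases hb : b ∈ Set.range p.val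
    · exact ⟨e, .inl hb⟩
    -- Composing with a transposition of the fresh elements makes b one of the new labels.
    · refine ⟨e.trans (Equiv.swap (e fun _ => false) ⟨b, hb⟩).toEmbedding,
        .inr ⟨fun _ => false, ?_⟩⟩
      simp
  let v : Fin (p.width + 1) × (Fin p.depth → Bool) → M := fun z =>
    Fin.lastCases (motive := fun _ => M) (e z.2 : M) (fun j => p.val (j, z.2)) z.1
  have hv₁ (j s) : v (Fin.castSucc j, s) = p.val (j, s) := by simp [v]
  have hv₂ (s) : v (Fin.last _, s) = e s := by simp [v]
  refine ⟨⟨p.width + 1, p.depth, v, ?_⟩, rfl, rfl, fun x hx => ?_, ?_⟩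
  · rintro ⟨j, s⟩ ⟨j', s'⟩ h
    induction j using Fin.lastCases with
    | last =>
      induction j' using Fin.lastCases with
      | last =>
        rw [hv₂, hv₂] at h
        rw [e.injective (Subtype.ext h)]
      | cast j' =>
        rw [hv₂, hv₁] at h
        exact absurd ⟨_, h.symm⟩ (e s).2
    | cast j =>
      induction j' using Fin.lastCases with
      | last =>
        rw [hv₂, hv₁] at h
        exact absurd ⟨_, h⟩ (e s').2
      | cast j' =>
        rw [hv₁, hv₁] at h
        have := p.val_injective h
        simp_all
  · rw [eval_of_lt _ hx, eval_of_lt _ (by simpa using Nat.lt_succ_of_lt hx)]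
    exact hv₁ ⟨x.1, hx⟩ _
  · rcases he with ⟨⟨j, s⟩, rfl⟩ | ⟨s, rfl⟩
    · exact ⟨(j.castSucc, s), hv₁ j s⟩
    · exact ⟨(Fin.last _, s), hv₂ s⟩

theorem le_of_eval_eq {p q : Approx L M} (hw : p.width ≤ q.width)
    (h : ∀ x : ℕ × (ℕ → Bool), x.1 < p.width → q.eval x = p.eval x) : p ≤ q :=
  ⟨hw, fun _ hS => ⟨.refl L M, fun x hx => (h x (hS.1 x hx)).symm⟩⟩

theorem exists_extend_subset [Infinite M] (p : Approx L M) {B : Set M} (hB : B.Finite) :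
    ∃ q : Approx L M, p.width ≤ q.width ∧
      (∀ x : ℕ × (ℕ → Bool), x.1 < p.width → q.eval x = p.eval x) ∧ B ⊆ Set.range q.val := by
  induction B, hB using Set.Finite.induction_on with
  | empty => exact ⟨p, le_rfl, fun _ _ => rfl, Set.empty_subset _⟩
  | insert _ _ ih =>
    rename_i b B _ _
    obtain ⟨q, hq₁, hq₂, hq₃⟩ := ih
    obtain ⟨r, hr₁, -, hr₂, hr₃⟩ := q.exists_extend_mem b
    refine ⟨r, by omega, fun x hx => (hr₂ x (by omega)).trans (hq₂ x hx),
      Set.insert_subset hr₃ fun m hm => ?_⟩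
    obtain ⟨x, hx, rfl⟩ := exists_eval_of_mem_range (hq₃ hm)
    rw [← hr₂ x hx]
    exact eval_mem_range (by omega)

end Approx

/-! ### Duplicating elements under trivial definable closure -/

theorem HasTrivialDcl.exists_moving {L : FirstOrder.Language.{u, v}} {M : Type w} [L.Structure M]
    (h : HasTrivialDcl L M) {C : Set M} (hC : C.Finite) {c : M} (hc : c ∉ C) :
    ∃ g : M ≃[L] M, (∀ m ∈ C, g m = m) ∧ g c ≠ c := by
  obtain ⟨n, a, -, rfl⟩ := hC.fin_param
  by_contra! hg
  rw [← h n a] at hc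
  exact hc fun g hga => hg g (by rintro _ ⟨i, rfl⟩; exact hga i)

/-- In a structure with trivial definable closure, every element of a finite injective tuple can
be duplicated so that all choices of duplicates realize the same type. -/
theorem HasTrivialDcl.exists_duplicate {L : FirstOrder.Language.{u, v}} {M : Type w}
    [L.Structure M] (htriv : HasTrivialDcl L M) {ι : Type*} [Finite ι] {a : ι → M}
    (ha : Function.Injective a) :
    ∃ d : ι → Bool → M, Function.Injective (fun z : ι × Bool => d z.1 z.2) ∧
      ∀ f : ι → Bool, ∃ h : M ≃[L] M, ∀ i, h (a i) = d i (f i) := by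
  classical
  have := Fintype.ofFinite ι
  -- Duplicates are created one index at a time; D is the set of indices already treated.
  suffices H : ∀ D : Finset ι, ∃ b : ι → M, (∀ i ∈ D, ∀ j, b i ≠ a j) ∧ Set.InjOn b D ∧
      ∀ f : ι → Bool, (∀ i, f i = true → i ∈ D) →
        ∃ h : M ≃[L] M, ∀ i, h (a i) = if f i then b i else a i by
    obtain ⟨b, hab, hb, hf⟩ := H Finset.univ
    refine ⟨fun i c => if c then b i else a i, ?_, fun f => hf f fun _ _ => Finset.mem_univ _⟩
    rintro ⟨i, _ | _⟩ ⟨j, _ | _⟩ h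
    · simpa using ha h
    · exact absurd h.symm (hab j (Finset.mem_univ _) i)
    · exact absurd h (hab i (Finset.mem_univ _) j)
    · simpa using hb (by simp) (by simp) h
  intro D
  induction D using Finset.induction_on with
  | empty => exact ⟨a, by simp, by simp, fun f hf => ⟨.refl L M, fun i => by simp⟩⟩
  | insert i₀ D hi₀ ih =>
    obtain ⟨b, hab, hb, hf⟩ := ih
    -- The new duplicate is g (a i₀), where g fixes the other entries of a and all earlier
    -- duplicates. A selection using it is the image under g of the same selection with a i₀
    -- instead.
    obtain ⟨g, hg, hg₀⟩ := htriv.exists_moving (C := a '' {i₀}ᶜ ∪ b '' D) (c := a i₀)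
      ((Set.toFinite _).union (Set.toFinite _)) (by
        rintro (⟨j, hj, hj'⟩ | ⟨j, hj, hj'⟩)
        · exact hj (ha hj')
        · exact hab j hj i₀ hj')
    have hga (j) (hj : j ≠ i₀) : g (a j) = a j := hg _ (.inl ⟨j, hj, rfl⟩)
    have hgb (j) (hj : j ∈ D) : g (b j) = b j := hg _ (.inr ⟨j, hj, rfl⟩)
    have hne (j) : g (a i₀) ≠ a j := by
      by_cases hj : j = i₀
      · rwa [hj]
      · rw [← hga j hj]
        exact fun h => hj (ha (g.injective h)).symm
    have hneb (j) (hj : j ∈ D) : b j ≠ g (a i₀) := by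
      rw [← hgb j hj]
      exact fun h => hab j hj _ (g.injective h)
    have hD (j) (hj : j ∈ D) : j ≠ i₀ := fun h => hi₀ (h ▸ hj)
    refine ⟨Function.update b i₀ (g (a i₀)), ?_, ?_, fun f hfD => ?_⟩
    · intro i hi j
      rcases Finset.mem_insert.1 hi with rfl | hi
      · simpa using hne j
      · simpa [hD i hi] using hab i hi j
    · intro i hi j hj hij
      rcases Finset.mem_insert.1 hi with hi' | hi' <;>
        rcases Finset.mem_insert.1 hj with hj' | hj'
      · rw [hi', hj']
      · simp only [hi', Function.update_self, Function.update_of_ne (hD j hj')] at hij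
        exact absurd hij.symm (hneb j hj')
      · simp only [hj', Function.update_self, Function.update_of_ne (hD i hi')] at hij
        exact absurd hij (hneb i hi')
      · simp only [Function.update_of_ne (hD i hi'), Function.update_of_ne (hD j hj')] at hij
        exact hb hi' hj' hij
    · obtain ⟨h, hh⟩ := hf (Function.update f i₀ false) (fun i hi => by
        by_cases hi₀' : i = i₀
        · simp [hi₀'] at hi
        · rw [Function.update_of_ne hi₀'] at hi
          exact (Finset.mem_insert.1 (hfD i hi)).resolve_left hi₀')
      by_cases hf₀ : f i₀ = true
      · refine ⟨g.comp h, fun i => ?_⟩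
        rw [FirstOrder.Language.Equiv.comp_apply, hh]
        by_cases hi : i = i₀
        · subst hi; simp [hf₀]
        · simp only [Function.update_of_ne hi]
          by_cases hfi : f i = true
          · simpa [hfi] using hgb i ((Finset.mem_insert.1 (hfD i hfi)).resolve_left hi)
          · simpa [hfi] using hga i hi
      · refine ⟨h, fun i => ?_⟩
        rw [hh]
        by_cases hi : i = i₀
        · subst hi; simp [hf₀]
        · simp only [Function.update_of_ne hi]

/-! ### Refining approximations and realizing types -/

namespace Approx

variable {L : FirstOrder.Language.{u, v}} {M : Type w} [L.Structure M]

theorem exists_split [Nonempty M] (htriv : HasTrivialDcl L M) (p : Approx L M) :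
    ∃ q ≥ p, q.depth = p.depth + 1 := by
  classical
  obtain ⟨d, hd, hsel⟩ := htriv.exists_duplicate p.val_injective
  refine ⟨⟨p.width, p.depth + 1, fun z => d (z.1, Fin.init z.2) (z.2 (Fin.last _)), ?_⟩,
    ⟨le_rfl, fun S hS => ?_⟩, rfl⟩
  · rintro ⟨j, s⟩ ⟨j', s'⟩ h
    have h' := @hd ((j, Fin.init s), s (Fin.last _)) ((j', Fin.init s'), s' (Fin.last _)) h
    simp only [Prod.mk.injEq] at h' ⊢
    refine ⟨h'.1.1, ?_⟩
    rw [← Fin.snoc_init_self s, ← Fin.snoc_init_self s', h'.1.2, h'.2]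
  -- Each cone contains at most one point of S, and the selection takes the half containing it, read
  -- off from its next bit.
  · obtain ⟨h, hh⟩ := hsel fun z =>
      decide (∃ x ∈ S, p.eval x = p.val z ∧ x.2 p.depth = true)
    refine ⟨h, fun x hx => ?_⟩
    have hx₁ := hS.1 x hx
    rw [p.eval_of_lt hx₁, hh, eval_of_lt _ (by exact hx₁)]
    refine congrArg (d _) (Bool.eq_iff_iff.2 ?_)
    rw [decide_eq_true_iff]
    constructor
    · rintro ⟨y, hy, hyx, hy'⟩
      rw [← p.eval_of_lt hx₁] at hyx
      obtain rfl := hS.2 hy hx hyx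
      exact hy'
    · exact fun hx' => ⟨x, hx, p.eval_of_lt hx₁, hx'⟩

theorem exists_large [Infinite M] (htriv : HasTrivialDcl L M) (p : Approx L M) (m : ℕ) :
    ∃ q ≥ p, m ≤ q.width ∧ m ≤ q.depth := by
  have h₁ : ∃ q ≥ p, m ≤ q.depth := by
    induction m with
    | zero => exact ⟨p, le_rfl, Nat.zero_le _⟩
    | succ m ih =>
      obtain ⟨q, hq, hm⟩ := ih
      obtain ⟨r, hr, hr'⟩ := q.exists_split htriv
      exact ⟨r, hq.trans hr, by omega⟩
  obtain ⟨q, hq, hm⟩ := h₁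
  have h₂ : ∀ k, ∃ r ≥ q, k ≤ r.width ∧ r.depth = q.depth := by
    intro k
    induction k with
    | zero => exact ⟨q, le_rfl, Nat.zero_le _, rfl⟩
    | succ k ih =>
      obtain ⟨r, hr, hk, hrd⟩ := ih
      obtain ⟨t, ht₁, ht₂, ht₃, -⟩ := r.exists_extend_mem (Classical.arbitrary M)
      exact ⟨t, hr.trans (le_of_eval_eq (by omega) ht₃), by omega, by omega⟩
  obtain ⟨r, hr, hk, hrd⟩ := h₂ m
  exact ⟨r, hq.trans hr, hk, by omega⟩

/-- At the stage `q`, every type realized together with `b` over the points resolved by `p` is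
realized by a point. -/
def Meets [Nonempty M] (p : Approx L M) (b : M) (q : Approx L M) : Prop :=
  ∀ S, p.Resolves S → ∃ h : M ≃[L] M, (∀ x ∈ S, h (p.eval x) = q.eval x) ∧
    ∃ y, q.eval y = h b ∧ q.Resolves (insert y S)

theorem exists_meets [Infinite M] {p q : Approx L M} (hpq : p ≤ q) (b : M) :
    ∃ r ≥ q, p.Meets b r := by
  classical
  -- There may be infinitely many S, but only the graph of p-labels against q-labels over S matters,
  -- and these graphs are subsets of a finite set. So finitely many values of c suffice as new
  -- labels.
  let c : Set (M × M) → M := fun W =>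
    if h : ∃ h : M ≃[L] M, ∀ z ∈ W, h z.1 = z.2 then h.choose b else b
  have hF : (Set.range p.val ×ˢ Set.range q.val).Finite :=
    (Set.finite_range _).prod (Set.finite_range _)
  obtain ⟨r, hr₁, hr₂, hr₃⟩ := q.exists_extend_subset (hF.finite_subsets.image c)
  have hqr : q ≤ r := le_of_eval_eq hr₁ hr₂
  refine ⟨r, hqr, fun S hS => ?_⟩
  have hW : ∃ h : M ≃[L] M, ∀ z ∈ (fun x => (p.eval x, q.eval x)) '' S, h z.1 = z.2 := by
    obtain ⟨h, hh⟩ := hpq.2 S hS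
    exact ⟨h, by rintro _ ⟨x, hx, rfl⟩; exact hh x hx⟩
  have hSr : r.Resolves S := hS.mono (hpq.trans hqr)
  refine ⟨hW.choose, fun x hx => ?_, ?_⟩
  · rw [hr₂ x ((hS.1 x hx).trans_le hpq.1)]
    exact hW.choose_spec _ ⟨x, hx, rfl⟩
  · by_cases hy : ∃ y ∈ S, r.eval y = hW.choose b
    · obtain ⟨y, hyS, hy⟩ := hy
      exact ⟨y, hy, by rwa [Set.insert_eq_of_mem hyS]⟩
    · push Not at hy
      have hmem : hW.choose b ∈ Set.range r.val := by
        refine hr₃ ⟨(fun x => (p.eval x, q.eval x)) '' S, ?_, dif_pos hW⟩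
        rintro _ ⟨x, hx, rfl⟩
        exact ⟨eval_mem_range (hS.1 x hx), eval_mem_range ((hS.1 x hx).trans_le hpq.1)⟩
      obtain ⟨y, hyr, hyb⟩ := exists_eval_of_mem_range hmem
      refine ⟨y, hyb, ?_, ?_⟩
      · rintro x (rfl | hx)
        · exact hyr
        · exact hSr.1 x hx
      · rintro x (rfl | hx) x' (rfl | hx') hxx'
        · rfl
        · exact absurd (hxx'.symm.trans hyb) (hy x' hx')
        · exact absurd (hxx'.trans hyb) (hy x hx)
        · exact hSr.2 hx hx' hxx'

/-! ### Generic sequences and the limit structure -/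

/-- An increasing sequence of approximations that determines a structure on `ℕ × (ℕ → Bool)` with
the extension property. -/
structure IsGeneric [Nonempty M] (s : ℕ → Approx L M) : Prop where
  mono : Monotone s
  large : ∀ m, ∃ i, m ≤ (s i).width ∧ m ≤ (s i).depth
  meets : ∀ i b, ∃ j, (s i).Meets b (s j)

theorem exists_isGeneric [Countable M] [Infinite M] (htriv : HasTrivialDcl L M) :
    ∃ s : ℕ → Approx L M, IsGeneric s := by
  classical
  have := Encodable.ofCountable (Approx L M × M)
  let D : ℕ ⊕ (Approx L M × M) → Order.Cofinal (Approx L M)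
    | .inl m => ⟨{q | m ≤ q.width ∧ m ≤ q.depth},
        fun p => let ⟨q, hq, h⟩ := p.exists_large htriv m; ⟨q, h, hq⟩⟩
    -- The demand is made only of q compatible with p, which keeps the set cofinal; all stages of
    -- the sequence are mutually compatible.
    | .inr (p, b) => ⟨{q | (∃ r ≥ q, p ≤ r) → p.Meets b q}, fun q => by
        by_cases h : ∃ r ≥ q, p ≤ r
        · obtain ⟨r, hqr, hpr⟩ := h
          obtain ⟨t, hrt, ht⟩ := exists_meets hpr b
          exact ⟨t, fun _ => ht, hqr.trans hrt⟩
        · exact ⟨q, fun h' => absurd h' h, le_rfl⟩⟩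
  let p₀ : Approx L M := ⟨0, 0, fun z => z.1.elim0, fun z => z.1.elim0⟩
  have mono : Monotone (Order.sequenceOfCofinals p₀ D) := Order.sequenceOfCofinals.monotone _ _
  refine ⟨Order.sequenceOfCofinals p₀ D, mono, fun m => ?_, fun i b => ?_⟩
  · exact ⟨_, Order.sequenceOfCofinals.encode_mem p₀ D (.inl m)⟩
  · refine ⟨_, Order.sequenceOfCofinals.encode_mem p₀ D
      (.inr (Order.sequenceOfCofinals p₀ D i, b)) ⟨_, mono (le_max_right i _),
        mono (le_max_left i _)⟩⟩

theorem IsGeneric.eventually_resolves [Nonempty M] {s : ℕ → Approx L M} (hs : IsGeneric s)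
    {S : Set (ℕ × (ℕ → Bool))} (hS : S.Finite) : ∀ᶠ j in Filter.atTop, (s j).Resolves S := by
  have pair (x y : ℕ × (ℕ → Bool)) : ∀ᶠ j in Filter.atTop, (s j).Resolves {x, y} := by
    suffices h : ∃ j, (s j).Resolves {x, y} by
      obtain ⟨j, hj⟩ := h
      filter_upwards [Filter.eventually_ge_atTop j] with i hi
      exact hj.mono (hs.mono hi)
    -- A bit distinguishing x from y when they are distinct points of one copy; otherwise any k
    -- works.
    obtain ⟨k, hk⟩ : ∃ k, x ≠ y → x.1 = y.1 → x.2 k ≠ y.2 k := by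
      by_contra! h
      exact (h 0).1 (Prod.ext (h 0).2.1 (funext fun k => (h k).2.2))
    obtain ⟨j, hj₁, hj₂⟩ := hs.large (max (max x.1 y.1) k + 1)
    have hx : x.1 < (s j).width := by omega
    have hy : y.1 < (s j).width := by omega
    have hne : (s j).eval x = (s j).eval y → x = y := by
      rw [eval_of_lt _ hx, eval_of_lt _ hy]
      intro h
      have := (s j).val_injective h
      simp only [Prod.mk.injEq, Fin.mk.injEq] at this
      by_contra hxy
      exact hk hxy this.1 (congrFun this.2 ⟨k, by omega⟩)
    refine ⟨j, ?_, ?_⟩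
    · rintro _ (rfl | rfl) <;> assumption
    · rintro _ (rfl | rfl) _ (rfl | rfl) h
      · rfl
      · exact hne h
      · exact (hne h.symm).symm
      · rfl
  have := (Filter.eventually_all_finite hS).2 fun x _ =>
    (Filter.eventually_all_finite hS).2 fun y _ => pair x y
  filter_upwards [this] with j hj
  exact ⟨fun x hx => (hj x hx x hx).1 x (by simp),
    fun x hx y hy h => (hj x hx y hy).2 (by simp) (by simp) h⟩

open Classical in
/-- The structure on `ℕ × (ℕ → Bool)` determined by a generic sequence. -/
@[reducible] noncomputable def limitStructure [Nonempty M] (s : ℕ → Approx L M) :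
    L.Structure (ℕ × (ℕ → Bool)) where
  funMap f x :=
    -- For a generic sequence over M with trivial definable closure, the default branch never
    -- occurs.
    if h : ∃ y, ∀ᶠ j in Filter.atTop,
      (s j).eval y = FirstOrder.Language.Structure.funMap f fun i => (s j).eval (x i)
    then h.choose else (0, fun _ => false)
  RelMap R x := ∀ᶠ j in Filter.atTop,
    FirstOrder.Language.Structure.RelMap R fun i => (s j).eval (x i)

/-- A function value lies in the definable closure of its arguments, hence is one of them. Which
argument it is can be read at a stage separating them, and automorphisms carry the choice to later
stages. -/
theorem IsGeneric.eventually_eval_funMap [Nonempty M] {s : ℕ → Approx L M} (hs : IsGeneric s)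
    (htriv : HasTrivialDcl L M) {l : ℕ} (f : L.Functions l) (x : Fin l → ℕ × (ℕ → Bool)) :
    ∀ᶠ j in Filter.atTop, (s j).eval ((limitStructure s).funMap f x) =
      FirstOrder.Language.Structure.funMap f fun i => (s j).eval (x i) := by
  have h : ∃ y, ∀ᶠ j in Filter.atTop,
      (s j).eval y = FirstOrder.Language.Structure.funMap f fun i => (s j).eval (x i) := by
    obtain ⟨i, hi⟩ := (hs.eventually_resolves (Set.finite_range x)).exists
    have hdcl : FirstOrder.Language.Structure.funMap f (fun k => (s i).eval (x k)) ∈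
        groupDcl L fun k => (s i).eval (x k) := by
      intro g hg
      rw [g.map_fun]
      exact congrArg _ (funext hg)
    rw [htriv] at hdcl
    obtain ⟨k, hk⟩ := hdcl
    refine ⟨x k, ?_⟩
    filter_upwards [Filter.eventually_ge_atTop i] with j hj
    obtain ⟨g, hg⟩ := (hs.mono hj).2 _ hi
    rw [← hg (x k) ⟨k, rfl⟩]
    simp only at hk
    rw [hk, g.map_fun]
    exact congrArg _ (funext fun k => hg (x k) ⟨k, rfl⟩)
  have heq : (limitStructure s).funMap f x = h.choose := dif_pos h
  rw [heq]
  exact h.choose_spec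

theorem IsGeneric.eventually_eval_realize [Nonempty M] {s : ℕ → Approx L M} (hs : IsGeneric s)
    (htriv : HasTrivialDcl L M) {n : ℕ} (x : Fin n → ℕ × (ℕ → Bool)) (t : L.Term (Fin n)) :
    letI := limitStructure s
    ∀ᶠ j in Filter.atTop, (s j).eval (t.realize x) = t.realize fun i => (s j).eval (x i) := by
  let _ := limitStructure s
  induction t with
  | var i => exact .of_forall fun _ => rfl
  | func f ts ih =>
    filter_upwards [Filter.eventually_all.2 ih,
      hs.eventually_eval_funMap htriv f fun i => (ts i).realize x] with j h₁ h₂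
    exact h₂.trans (congrArg _ (funext h₁))

/-- The limit of a generic sequence satisfies the same sentences of `L_{ω₁,ω}` as `M`. -/
theorem IsGeneric.holds_iff [Nonempty M] {s : ℕ → Approx L M} (hs : IsGeneric s)
    (htriv : HasTrivialDcl L M) (σ : InfSentence L) :
    letI := limitStructure s
    σ.Holds (ℕ × (ℕ → Bool)) ↔ σ.Holds M := by
  let _ := limitStructure s
  -- The correspondence says that a is eventually conjugate to the labels of x.
  refine InfFormula.realize_iff_of_backForth (fun n x a => ∀ᶠ j in Filter.atTop,
    ∃ h : M ≃[L] M, ∀ i, h (a i) = (s j).eval (x i)) ?_ ?_ ?_ ?_ σ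
    (.of_forall fun _ => ⟨.refl L M, fun i => i.elim0⟩)
  · intro n x a hxa t₁ t₂
    obtain ⟨j, ⟨h, hh⟩, h₁, h₂, hj⟩ := (hxa.and ((hs.eventually_eval_realize htriv x t₁).and
      ((hs.eventually_eval_realize htriv x t₂).and (hs.eventually_resolves
        (Set.toFinite {t₁.realize x, t₂.realize x}))))).exists
    have ha : (fun i => (s j).eval (x i)) = h ∘ a := (funext hh).symm
    rw [← hj.2.eq_iff (by simp) (by simp), h₁, h₂, ha, FirstOrder.Language.HomClass.realize_term,
      FirstOrder.Language.HomClass.realize_term, h.injective.eq_iff]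
  · intro n x a hxa l R ts
    -- By conjugacy, the truth value of R at late stages is the constant one at a.
    refine (Filter.eventually_congr ?_).trans Filter.eventually_const
    filter_upwards [hxa, Filter.eventually_all.2 fun i =>
      hs.eventually_eval_realize htriv x (ts i)] with j hj hts
    obtain ⟨h, hh⟩ := hj
    rw [funext hts, ← funext hh, ← h.map_rel R fun i => (ts i).realize a]
    exact iff_of_eq (congrArg _ (funext fun i =>
      FirstOrder.Language.HomClass.realize_term h (t := ts i) (v := a)))
  · intro n x a hxa y
    obtain ⟨j, ⟨h, hh⟩, hj⟩ := (hxa.and (hs.eventually_resolves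
      ((Set.finite_range x).insert y))).exists
    refine ⟨h.symm ((s j).eval y), ?_⟩
    filter_upwards [Filter.eventually_ge_atTop j] with k hk
    obtain ⟨g, hg⟩ := (hs.mono hk).2 _ hj
    refine ⟨g.comp h, ?_⟩
    rw [Fin.forall_fin_succ']
    refine ⟨fun i => ?_, ?_⟩
    · simpa [hh] using hg (x i) (by simp)
    · simpa using hg y (by simp)
  · intro n x a hxa b
    obtain ⟨j, ⟨h, hh⟩, hj⟩ := (hxa.and (hs.eventually_resolves (Set.finite_range x))).exists
    -- The element b is first transported by h to the labels of stage j; stage k then realizes it by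
    -- a point y separated along with x.
    obtain ⟨k, hk⟩ := hs.meets j (h b)
    obtain ⟨h', hh', y, hy, hk⟩ := hk _ hj
    refine ⟨y, ?_⟩
    filter_upwards [Filter.eventually_ge_atTop k] with k' hk'
    obtain ⟨g, hg⟩ := (hs.mono hk').2 _ hk
    refine ⟨g.comp (h'.comp h), ?_⟩
    rw [Fin.forall_fin_succ']
    refine ⟨fun i => ?_, ?_⟩
    · simpa [hh, hh' (x i) ⟨i, rfl⟩] using hg (x i) (by simp)
    · simpa [hy] using hg y (by simp)

end Approx

/-! ### Models of size continuum and the theorem -/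

/-- If `M` has trivial definable closure, then every sentence true in `M` has a model of the
cardinality of the continuum. -/
theorem HasTrivialDcl.hasContinuumSizedModel {L : FirstOrder.Language.{u, v}} {M : Type w}
    [L.Structure M] [Countable M] [Infinite M] (htriv : HasTrivialDcl L M) {σ : InfSentence L}
    (hσ : σ.Holds M) : HasContinuumSizedModel σ := by
  obtain ⟨s, hs⟩ := Approx.exists_isGeneric htriv
  refine ⟨ℕ × (ℕ → Bool), Approx.limitStructure s, ?_, (hs.holds_iff htriv σ).2 hσ⟩
  simp

theorem mainTheorem10 (L : FirstOrder.Language.{u, v}) [Countable L.Symbols]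
    (M : Type w) [L.Structure M] [Countable M] [Infinite M] :
    (∀ σ : InfSentence L, IsScottSentence M σ → ¬ HasContinuumSizedModel σ →
      ¬ AdmitsInvariantMeasure L M ∧ ¬ HasTrivialDcl L M) ∧
    (AbsolutelyCharacterizable L M →
      ¬ AdmitsInvariantMeasure L M ∧ ¬ HasTrivialDcl L M) := by
  have key (σ : InfSentence L) (hσ : IsScottSentence M σ) (hc : ¬ HasContinuumSizedModel σ) :
      ¬ AdmitsInvariantMeasure L M ∧ ¬ HasTrivialDcl L M :=
    ⟨fun h => hc (h.hasTrivialDcl.hasContinuumSizedModel hσ.holds),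
      fun h => hc (h.hasContinuumSizedModel hσ.holds)⟩
  refine ⟨key, ?_⟩
  rintro ⟨σ, hσ, hunc⟩
  refine key σ hσ ?_
  rintro ⟨N, _, hN, hNσ⟩
  have : Uncountable N := Cardinal.aleph0_lt_mk_iff.1 (hN ▸ Cardinal.aleph0_lt_continuum)
  exact hunc N hNσ
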